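/- Let $\ell_2=\ell_2(\mathbb N)$ denote the complex Hilbert space of square-summable sequences $z=(z_k)_{k\in\mathbb N}$, with norm $\|z\|_2=(\sum_k|z_k|^2)^{1/2}$ and with its Borel $\sigma$-algebra, and let $\|\cdot\|_{2\to2}$ denote the operator norm of bounded linear operators $\ell_2\to\ell_2$. For $y\in\ell_2$ let $y\otimes y:=y\,y^\ast$ be the bounded operator on $\ell_2$ with matrix entries $(y\otimes y)_{j,k}=y_j\overline{y_k}$. Let $n\ge 3$ be an integer, let $M>0$, and let $y^1,\dots,y^n$ be independent and identically distributed $\ell_2$-valued random variables on a probability space $(\Omega,\mathcal A,\mathbb P)$ such that $\|y^i\|_2\le M$ almost surely for every $i=1,\dots,n$. Put $\mathbf\Lambda:=\mathbb E\,(y^i\otimes y^i)$ (which does not depend on $i$) and assume that $\|\mathbf\Lambda\|_{2\to2}\le 1$. Then for every $0<t\le 1$ $$\mathbb P\Big(\Big\|\frac1n\sum_{i=1}^n y^i\otimes y^i-\mathbf\Lambda\Big\|_{2\to2}\ge t\Big)\le 2^{3/4}\,n\,\exp\Big(-\frac{t^2n}{21M^2}\Big).$$ -/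

import Mathlib

open scoped lp

/-- The Borel `σ`-algebra on the complex sequence space `ℓ₂`. -/
noncomputable instance instMeasurableSpaceEllTwo : MeasurableSpace ℓ²(ℕ, ℂ) := borel _

instance instBorelSpaceEllTwo : BorelSpace ℓ²(ℕ, ℂ) := ⟨rfl⟩

/-- The tensor `y ⊗ y = y · y*` of a sequence `y ∈ ℓ₂`, i.e. the bounded operator
`z ↦ ⟪y, z⟫ y` on `ℓ₂`, whose matrix has the entries `y j * conj (y k)`. -/
noncomputable def selfTensor (y : ℓ²(ℕ, ℂ)) : ℓ²(ℕ, ℂ) →L[ℂ] ℓ²(ℕ, ℂ) :=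
  InnerProductSpace.rankOne ℂ y y

/-!
The proof bounds the even trace moments of the centred sum `S = ∑ i, yⁱ ⊗ yⁱ - n • Λ` and applies
Markov's inequality to `tr S ^ (2 * p) ≥ ‖S‖ ^ (2 * p)`. All trace computations take place in the
finite `d × d` sections of the operators. The resulting bounds do not depend on `d`, and the norm of
an operator on `ℓ₂` is at most the lower limit of the norms of its sections
(`eventually_lt_norm_finiteSection`), so they pass to the limit.

The moments are controlled by a recursion that replaces symmetrization and the noncommutative
Khintchine inequality. Let `S'` be `S` with the `i`-th sample point exchanged for an independent
copy `y'`. Since the pair `(S, S')` is exchangeable, with `m = 2 * k + 1`,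
`E tr ((yⁱ ⊗ yⁱ - Λ) * S ^ m) = 1/2 * E tr ((S - S') * (S ^ m - S' ^ m))`, and the mean value
inequality for traces (`Matrix.IsHermitian.re_trace_sub_mul_pow_sub_pow_le`) bounds this by
`m/2 * E tr ((S - S') ^ 2 * S ^ (2 * k))`. Here `S - S' = yⁱ ⊗ yⁱ - y' ⊗ y'`, and
`(y ⊗ y) ^ 2 ≤ M ^ 2 • y ⊗ y`. Summing over `i` recovers `S` itself, because
`∑ i, yⁱ ⊗ yⁱ = S + n • Λ`; with `Λ ≤ 1` and Young's inequality this becomes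
`E tr S ^ (2 * k + 2) ≤ 4/3 * (v ^ 2 + 2 * n * v) * E tr S ^ (2 * k)` with `v = m * M ^ 2`
(`integral_re_trace_centeredSum_pow_succ_le`).

The recursion starts from `E tr S ^ 2 ≤ 2 * n * M ^ 2 * M ^ 2`, in which the dimension enters only
through `tr Λ ≤ M ^ 2`. With `L = t ^ 2 * n / (21 * M ^ 2)` and the moment order `p = ⌊L⌋`, every
step of the recursion contributes at most a factor `(n * t) ^ 2 / e` (`moment_bound_le`), which
yields the tail bound `n * exp (-L)` when `L ≥ 1`. When `L < 1`, the claimed bound exceeds one.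
-/

/-! ### Trace inequalities for Hermitian matrices -/

lemma sum_pow_mul_pow_le (a b : ℝ) (k : ℕ) :
    ∑ j ∈ Finset.range (2 * k + 1), a ^ j * b ^ (2 * k - j) ≤
      (2 * k + 1) / 2 * (a ^ (2 * k) + b ^ (2 * k)) := by
  have hrefl := Finset.sum_range_reflect (fun j => a ^ j * b ^ (2 * k - j)) (2 * k + 1)
  have hpair : ∀ j ∈ Finset.range (2 * k + 1),
      a ^ j * b ^ (2 * k - j) + a ^ (2 * k + 1 - 1 - j) * b ^ (2 * k - (2 * k + 1 - 1 - j)) ≤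
        a ^ (2 * k) + b ^ (2 * k) := by
    intro j hj
    obtain ⟨l, hl⟩ : ∃ l, 2 * k = j + l := ⟨2 * k - j, by grind⟩
    have e1 : 2 * k - j = l := by omega
    have e2 : 2 * k + 1 - 1 - j = l := by omega
    have e3 : 2 * k - l = j := by omega
    rw [e1, e2, e3]
    have habs : ∀ x : ℝ, x ^ (2 * k) = |x| ^ (2 * k) := fun x => by
      rw [pow_mul, pow_mul, sq_abs]
    rw [habs a, habs b, hl, pow_add, pow_add]
    have h1 : a ^ j * b ^ l ≤ |a| ^ j * |b| ^ l := by
      rw [← abs_pow, ← abs_pow, ← abs_mul]; exact le_abs_self _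
    have h2 : a ^ l * b ^ j ≤ |a| ^ l * |b| ^ j := by
      rw [← abs_pow, ← abs_pow, ← abs_mul]; exact le_abs_self _
    have h3 : 0 ≤ (|a| ^ j - |b| ^ j) * (|a| ^ l - |b| ^ l) := by
      rcases le_total |a| |b| with h | h
      · exact mul_nonneg_of_nonpos_of_nonpos
          (sub_nonpos.2 (by gcongr)) (sub_nonpos.2 (by gcongr))
      · exact mul_nonneg (sub_nonneg.2 (by gcongr)) (sub_nonneg.2 (by gcongr))
    nlinarith
  have := Finset.sum_le_sum hpair
  rw [Finset.sum_add_distrib, hrefl, Finset.sum_const, Finset.card_range, nsmul_eq_mul] at this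
  push_cast at this
  linarith

/-- The divided difference of the odd power `x ^ (2 * k + 1)` is at most the mean of its
derivative at the two endpoints. -/
lemma sub_mul_pow_sub_pow_le (a b : ℝ) (k : ℕ) :
    (a - b) * (a ^ (2 * k + 1) - b ^ (2 * k + 1)) ≤
      (2 * k + 1) / 2 * ((a - b) ^ 2 * (a ^ (2 * k) + b ^ (2 * k))) := by
  have h := Commute.geom_sum₂_mul (Commute.all a b) (2 * k + 1)
  rw [← h]
  have h2 := mul_le_mul_of_nonneg_left (sum_pow_mul_pow_le a b k) (sq_nonneg (a - b))
  simp only [Nat.add_sub_cancel]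
  nlinarith [h2]

section MatrixTrace

open Matrix
open scoped ComplexOrder

variable {ι : Type*} [Fintype ι] [DecidableEq ι]

lemma Matrix.IsHermitian.pow_eq_conj {A : Matrix ι ι ℂ} (hA : A.IsHermitian) (m : ℕ) :
    A ^ m = (hA.eigenvectorUnitary : Matrix ι ι ℂ) *
      diagonal (fun i => ((hA.eigenvalues i ^ m : ℝ) : ℂ)) *
        star (hA.eigenvectorUnitary : Matrix ι ι ℂ) := by
  conv_lhs => rw [hA.spectral_theorem]
  rw [← map_pow, Unitary.conjStarAlgAut_apply, diagonal_pow]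
  congr 3
  funext i
  simp

lemma Matrix.IsHermitian.re_trace_pow {A : Matrix ι ι ℂ} (hA : A.IsHermitian) (m : ℕ) :
    (A ^ m).trace.re = ∑ i, hA.eigenvalues i ^ m := by
  rw [hA.pow_eq_conj, trace_mul_cycle, Unitary.coe_star_mul_self, one_mul, trace_diagonal,
    ← Complex.ofReal_sum, Complex.ofReal_re]

/-- For Hermitian `A` and `B` with eigenvalues `aᵢ` and `bⱼ`, all the traces
`tr (A ^ k * B ^ l)` are the moments `∑ wᵢⱼ aᵢ ^ k bⱼ ^ l` of one and the same nonnegative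
weight `w`, the squared moduli of the overlaps of the eigenvectors. -/
lemma Matrix.IsHermitian.exists_re_trace_pow_mul_pow {A B : Matrix ι ι ℂ}
    (hA : A.IsHermitian) (hB : B.IsHermitian) :
    ∃ w : ι → ι → ℝ, (∀ i j, 0 ≤ w i j) ∧ ∀ k l : ℕ,
      (A ^ k * B ^ l).trace.re =
        ∑ i, ∑ j, w i j * (hA.eigenvalues i ^ k * hB.eigenvalues j ^ l) := by
  set U : Matrix ι ι ℂ := (hA.eigenvectorUnitary : Matrix ι ι ℂ)
  set V : Matrix ι ι ℂ := (hB.eigenvectorUnitary : Matrix ι ι ℂ)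
  refine ⟨fun i j => Complex.normSq ((star U * V) i j), fun i j => Complex.normSq_nonneg _,
    fun k l => ?_⟩
  rw [hA.pow_eq_conj, hB.pow_eq_conj]
  set D := diagonal (fun i => ((hA.eigenvalues i ^ k : ℝ) : ℂ))
  set E := diagonal (fun i => ((hB.eigenvalues i ^ l : ℝ) : ℂ))
  have h1 : (U * D * star U * (V * E * star V)).trace =
      (D * ((star U * V) * E * star (star U * V))).trace := by
    rw [star_mul, star_star]
    calc (U * D * star U * (V * E * star V)).trace
        = (U * (D * (star U * V * E * star V))).trace := by simp only [mul_assoc]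
      _ = (D * (star U * V * E * star V) * U).trace := trace_mul_comm _ _
      _ = _ := by simp only [mul_assoc]
  rw [h1]
  set W := star U * V
  have h2 : (D * (W * E * star W)).trace =
      ∑ i, ∑ j, ((Complex.normSq (W i j) *
        (hA.eigenvalues i ^ k * hB.eigenvalues j ^ l) : ℝ) : ℂ) := by
    simp only [trace, diag_apply, D, diagonal_mul]
    refine Finset.sum_congr rfl fun i _ => ?_
    rw [mul_apply, Finset.mul_sum]
    refine Finset.sum_congr rfl fun j _ => ?_
    simp only [E, mul_diagonal, star_apply]
    rw [Complex.ofReal_mul, ← Complex.mul_conj, Complex.ofReal_mul]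
    simp only [starRingEnd_apply]
    ring
  rw [h2]
  simp only [← Complex.ofReal_sum, Complex.ofReal_re]

/-- The mean value inequality for the trace of the odd power `2 * k + 1`. -/
lemma Matrix.IsHermitian.re_trace_sub_mul_pow_sub_pow_le {A B : Matrix ι ι ℂ}
    (hA : A.IsHermitian) (hB : B.IsHermitian) (k : ℕ) :
    ((A - B) * (A ^ (2 * k + 1) - B ^ (2 * k + 1))).trace.re ≤
      (2 * k + 1) / 2 * (((A - B) ^ 2 * A ^ (2 * k)).trace.re +
        ((A - B) ^ 2 * B ^ (2 * k)).trace.re) := by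
  obtain ⟨w, hw, h⟩ := hA.exists_re_trace_pow_mul_pow hB
  have hcyc : ∀ X Y : Matrix ι ι ℂ, (X * Y).trace = (Y * X).trace := trace_mul_comm
  have e1 : ((A - B) * (A ^ (2 * k + 1) - B ^ (2 * k + 1))).trace =
      (A ^ (2 * k + 2) * B ^ 0).trace - (A ^ 1 * B ^ (2 * k + 1)).trace
        - (A ^ (2 * k + 1) * B ^ 1).trace + (A ^ 0 * B ^ (2 * k + 2)).trace := by
    simp only [sub_mul, mul_sub, trace_sub, pow_zero, one_mul, mul_one, pow_one]
    rw [hcyc B (A ^ _), ← pow_succ', ← pow_succ']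
    ring
  have e2 : ((A - B) ^ 2 * A ^ (2 * k)).trace =
      (A ^ (2 * k + 2) * B ^ 0).trace - 2 * (A ^ (2 * k + 1) * B ^ 1).trace
        + (A ^ (2 * k) * B ^ 2).trace := by
    have : (A - B) ^ 2 * A ^ (2 * k) =
        A ^ (2 * k + 2) - A * B * A ^ (2 * k) - B * A * A ^ (2 * k) + B ^ 2 * A ^ (2 * k) := by
      rw [show 2 * k + 2 = 2 + 2 * k by ring, pow_add A 2]
      noncomm_ring
    rw [this]
    simp only [trace_add, trace_sub, pow_zero, mul_one, pow_one]
    rw [hcyc (A * B) (A ^ _), ← mul_assoc, ← pow_succ, mul_assoc B, ← pow_succ',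
      hcyc B, hcyc (B ^ 2)]
    ring
  have e3 : ((A - B) ^ 2 * B ^ (2 * k)).trace =
      (A ^ 0 * B ^ (2 * k + 2)).trace - 2 * (A ^ 1 * B ^ (2 * k + 1)).trace
        + (A ^ 2 * B ^ (2 * k)).trace := by
    have : (A - B) ^ 2 * B ^ (2 * k) =
        B ^ (2 * k + 2) - A * B * B ^ (2 * k) - B * A * B ^ (2 * k) + A ^ 2 * B ^ (2 * k) := by
      rw [show 2 * k + 2 = 2 + 2 * k by ring, pow_add B 2]
      noncomm_ring
    rw [this]
    simp only [trace_add, trace_sub, pow_zero, one_mul, pow_one]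
    rw [mul_assoc A B, ← pow_succ', mul_assoc B A, hcyc B, mul_assoc A, ← pow_succ]
    ring
  rw [e1, e2, e3]
  simp only [Complex.add_re, Complex.sub_re, Complex.mul_re, Complex.re_ofNat, Complex.im_ofNat,
    zero_mul, sub_zero, h]
  simp only [← Finset.sum_add_distrib, ← Finset.sum_sub_distrib, Finset.mul_sum]
  refine Finset.sum_le_sum fun i _ => Finset.sum_le_sum fun j _ => ?_
  have := mul_le_mul_of_nonneg_left
    (sub_mul_pow_sub_pow_le (hA.eigenvalues i) (hB.eigenvalues j) k) (hw i j)
  refine (le_of_eq ?_).trans (this.trans (le_of_eq ?_)) <;> ring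

lemma Matrix.PosSemidef.re_trace_mul_sq_nonneg {Q T : Matrix ι ι ℂ} (hQ : Q.PosSemidef)
    (hT : T.IsHermitian) : 0 ≤ (Q * T ^ 2).trace.re := by
  have h := (Complex.le_def.1 (hQ.conjTranspose_mul_mul_same T).trace_nonneg).1
  rwa [hT.eq, mul_assoc, trace_mul_comm, mul_assoc, ← pow_two] at h

/-- The trace form of `(A - B) ^ 2 ≤ 2 • (A ^ 2 + B ^ 2)`. -/
lemma Matrix.IsHermitian.re_trace_sub_sq_mul_sq_le {A B T : Matrix ι ι ℂ} (hA : A.IsHermitian)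
    (hB : B.IsHermitian) (hT : T.IsHermitian) :
    ((A - B) ^ 2 * T ^ 2).trace.re ≤
      2 * ((A ^ 2 * T ^ 2).trace.re + (B ^ 2 * T ^ 2).trace.re) := by
  have h := (posSemidef_conjTranspose_mul_self (A + B)).re_trace_mul_sq_nonneg hT
  rw [(hA.add hB).eq] at h
  have e : (A - B) ^ 2 * T ^ 2 + (A + B) * (A + B) * T ^ 2 =
      (2 : ℂ) • (A ^ 2 * T ^ 2 + B ^ 2 * T ^ 2) := by
    rw [two_smul]; noncomm_ring
  have := congrArg (fun X => (trace X).re) e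
  simp [trace_add, trace_smul] at this
  linarith

/-- Young's inequality for the odd moment `2 * k + 1`. -/
lemma Matrix.IsHermitian.re_trace_pow_odd_le {S : Matrix ι ι ℂ} (hS : S.IsHermitian) (k : ℕ)
    {c : ℝ} (hc : 0 < c) :
    (S ^ (2 * k + 1)).trace.re ≤
      c / 2 * (S ^ (2 * k + 2)).trace.re + 1 / (2 * c) * (S ^ (2 * k)).trace.re := by
  rw [hS.re_trace_pow, hS.re_trace_pow, hS.re_trace_pow, Finset.mul_sum, Finset.mul_sum,
    ← Finset.sum_add_distrib]
  refine Finset.sum_le_sum fun i _ => ?_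
  set s := hS.eigenvalues i
  have h : 0 ≤ s ^ (2 * k) * (1 / (2 * c) * (c * s - 1) ^ 2) :=
    mul_nonneg ((even_two_mul k).pow_nonneg s) (by positivity)
  have e : s ^ (2 * k) * (1 / (2 * c) * (c * s - 1) ^ 2) =
      c / 2 * s ^ (2 * k + 2) + 1 / (2 * c) * s ^ (2 * k) - s ^ (2 * k + 1) := by
    field_simp; ring
  linarith

open scoped Matrix.Norms.L2Operator in
/-- The operator norm of a Hermitian matrix is its largest absolute eigenvalue, hence dominated by
every even trace moment. -/
lemma Matrix.IsHermitian.norm_toEuclideanCLM_pow_le {S : Matrix ι ι ℂ} (hS : S.IsHermitian)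
    {p : ℕ} (hp : p ≠ 0) :
    ‖toEuclideanCLM (𝕜 := ℂ) S‖ ^ (2 * p) ≤ (S ^ (2 * p)).trace.re := by
  rw [hS.re_trace_pow, l2_opNorm_toEuclideanCLM]
  have h : ‖S‖ = ‖hS.eigenvalues‖ := by
    conv_lhs => rw [hS.spectral_theorem]
    rw [Unitary.conjStarAlgAut_apply, ← Unitary.coe_star, CStarRing.norm_mul_coe_unitary,
      CStarRing.norm_coe_unitary_mul, l2_opNorm_diagonal]
    simp [Pi.norm_def, Function.comp_def, Complex.nnnorm_real]
  rw [h]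
  cases isEmpty_or_nonempty ι
  · rw [Subsingleton.elim hS.eigenvalues 0]; simp [hp]
  obtain ⟨i, hi⟩ : ∃ i, ‖hS.eigenvalues‖ = ‖hS.eigenvalues i‖ := by
    obtain ⟨i, -, hi⟩ := Finset.exists_mem_eq_sup Finset.univ Finset.univ_nonempty
      (fun i => ‖hS.eigenvalues i‖₊)
    exact ⟨i, by rw [Pi.norm_def, hi]; rfl⟩
  rw [hi, Real.norm_eq_abs, pow_mul, sq_abs, ← pow_mul]
  exact Finset.single_le_sum (f := fun i => hS.eigenvalues i ^ (2 * p))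
    (fun j _ => (even_two_mul p).pow_nonneg _) (Finset.mem_univ i)

end MatrixTrace

/-! ### Replacing one coordinate of an i.i.d. sample by an independent copy -/

section Sample

open MeasureTheory

/-- The exchange of the `i`-th sample point `x i` with the additional sample point `y`. -/
def exchange {E : Type*} {n : ℕ} (i : Fin n) (z : E × (Fin n → E)) : E × (Fin n → E) :=
  (z.2 i, Function.update z.2 i z.1)

/-- The exchange is the transposition of two coordinates of an i.i.d. sample of size `n + 1`. -/
lemma measurePreserving_exchange {E : Type*} [MeasurableSpace E] (ν : Measure E)
    [IsProbabilityMeasure ν] {n : ℕ} (i : Fin n) :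
    MeasurePreserving (exchange i) (ν.prod (Measure.pi fun _ : Fin n => ν))
      (ν.prod (Measure.pi fun _ : Fin n => ν)) := by
  have h1 := measurePreserving_piFinSuccAbove (fun _ : Fin (n + 1) => ν) 0
  have h2 := measurePreserving_piCongrLeft (fun _ : Fin (n + 1) => ν) (Equiv.swap 0 i.succ)
  have h3 := (h1.comp h2).comp (h1.symm _)
  convert h3 using 1
  funext z
  have key : ∀ x : Fin (n + 1) → E, ∀ k,
      (MeasurableEquiv.piCongrLeft (fun _ => E) (Equiv.swap 0 i.succ)) x k =
        x (Equiv.swap 0 i.succ k) := by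
    intro x k
    have := MeasurableEquiv.piCongrLeft_apply_apply (β := fun _ => E) (Equiv.swap 0 i.succ) x
      (Equiv.swap 0 i.succ k)
    rwa [Equiv.swap_apply_self] at this
  refine Prod.ext ?_ (funext fun j => ?_)
  · simp [exchange, MeasurableEquiv.piFinSuccAbove, key, Fin.insertNthEquiv]
  · rcases eq_or_ne j i with rfl | hj
    · simp [exchange, MeasurableEquiv.piFinSuccAbove, key, Fin.insertNthEquiv, Fin.tail]
    · have : Equiv.swap 0 i.succ j.succ = j.succ :=
        Equiv.swap_apply_of_ne_of_ne (Fin.succ_ne_zero j) (by simpa using hj)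
      simp [exchange, MeasurableEquiv.piFinSuccAbove, key, Fin.insertNthEquiv, Fin.tail, hj, this]

lemma continuous_exchange {E : Type*} [TopologicalSpace E] {n : ℕ} (i : Fin n) :
    Continuous (exchange (E := E) i) :=
  ((continuous_apply i).comp continuous_snd).prodMk
    (continuous_snd.update i continuous_fst)

lemma integral_comp_exchange {E : Type*} [MeasurableSpace E] (ν : Measure E)
    [IsProbabilityMeasure ν] {n : ℕ} (i : Fin n) {f : E × (Fin n → E) → ℝ}
    (hf : AEStronglyMeasurable f (ν.prod (Measure.pi fun _ : Fin n => ν))) :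
    ∫ z, f (exchange i z) ∂(ν.prod (Measure.pi fun _ : Fin n => ν)) =
      ∫ z, f z ∂(ν.prod (Measure.pi fun _ : Fin n => ν)) := by
  have h := measurePreserving_exchange ν i
  rw [← integral_map h.measurable.aemeasurable (by rwa [h.map_eq]), h.map_eq]

lemma integrable_of_continuous_of_ae_mem {X : Type*} [TopologicalSpace X] [T2Space X]
    [MeasurableSpace X] [OpensMeasurableSpace X] {μ : Measure X}
    [IsFiniteMeasure μ] {F : Type*} [NormedAddCommGroup F]
    [SecondCountableTopologyEither X F] {K : Set X} (hK : IsCompact K)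
    (hμ : ∀ᵐ x ∂μ, x ∈ K) {f : X → F}
    (hf : Continuous f) : Integrable f μ := by
  have h := hf.continuousOn.integrableOn_compact (μ := μ) hK
  rwa [IntegrableOn, Measure.restrict_eq_self_of_ae_mem hμ] at h

lemma ae_pi_of_ae {E : Type*} [MeasurableSpace E] {ν : Measure E} [IsProbabilityMeasure ν]
    {n : ℕ} {p : E → Prop} (h : ∀ᵐ y ∂ν, p y) :
    ∀ᵐ x ∂(Measure.pi fun _ : Fin n => ν), ∀ i, p (x i) :=
  ae_all_iff.2 fun i => (Measure.quasiMeasurePreserving_eval (fun _ : Fin n => ν) i).ae h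

lemma ae_prod_pi_of_ae {E : Type*} [MeasurableSpace E] {ν : Measure E} [IsProbabilityMeasure ν]
    {n : ℕ} {p : E → Prop} (h : ∀ᵐ y ∂ν, p y) :
    ∀ᵐ z ∂(ν.prod (Measure.pi fun _ : Fin n => ν)), p z.1 ∧ ∀ i, p (z.2 i) :=
  (Measure.quasiMeasurePreserving_fst.ae h).and
    (Measure.quasiMeasurePreserving_snd.ae (ae_pi_of_ae h))

end Sample

/-! ### Trace moments of centred sums of random rank-one matrices -/

section Moments

open MeasureTheory Matrix
open scoped ComplexOrder

variable {ι : Type*}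

/-- The rank-one matrix `y y*` with the entries `y j * conj (y k)`. -/
def outerSq (y : ι → ℂ) : Matrix ι ι ℂ := vecMulVec y (star y)

lemma isHermitian_outerSq (y : ι → ℂ) : (outerSq y).IsHermitian := by
  ext j k; simp [outerSq, vecMulVec_apply, mul_comm]

@[fun_prop]
lemma continuous_outerSq : Continuous (outerSq : (ι → ℂ) → Matrix ι ι ℂ) :=
  continuous_id.matrix_vecMulVec continuous_star

/-- The centred sum `∑ i, x i (x i)* - n • Λ`. -/
def centeredSum {n : ℕ} (Λ : Matrix ι ι ℂ) (x : Fin n → ι → ℂ) : Matrix ι ι ℂ :=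
  ∑ i, outerSq (x i) - (n : ℂ) • Λ

lemma isHermitian_centeredSum {n : ℕ} {Λ : Matrix ι ι ℂ} (hΛ : Λ.IsHermitian)
    (x : Fin n → ι → ℂ) : (centeredSum Λ x).IsHermitian := by
  refine IsHermitian.sub ?_ ?_
  · rw [IsHermitian, conjTranspose_sum]
    exact Finset.sum_congr rfl fun i _ => isHermitian_outerSq _
  · rw [IsHermitian, conjTranspose_smul, hΛ.eq]; simp

@[fun_prop]
lemma continuous_centeredSum {n : ℕ} (Λ : Matrix ι ι ℂ) :
    Continuous (centeredSum Λ : (Fin n → ι → ℂ) → Matrix ι ι ℂ) := by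
  unfold centeredSum; fun_prop

lemma centeredSum_sub_exchange {n : ℕ} (Λ : Matrix ι ι ℂ) (i : Fin n)
    (z : (ι → ℂ) × (Fin n → ι → ℂ)) :
    centeredSum Λ z.2 - centeredSum Λ (exchange i z).2 = outerSq (z.2 i) - outerSq z.1 := by
  have h : ∀ x : Fin n → ι → ℂ, ∑ j, outerSq (x j) =
      outerSq (x i) + ∑ j ∈ Finset.univ.erase i, outerSq (x j) := fun x =>
    (Finset.add_sum_erase _ (fun j => outerSq (x j)) (Finset.mem_univ i)).symm
  have h2 : ∑ j ∈ Finset.univ.erase i, outerSq (Function.update z.2 i z.1 j) =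
      ∑ j ∈ Finset.univ.erase i, outerSq (z.2 j) :=
    Finset.sum_congr rfl fun j hj => by rw [Function.update_of_ne (Finset.ne_of_mem_erase hj)]
  simp only [centeredSum, exchange]
  rw [h z.2, h (Function.update z.2 i z.1), h2, Function.update_self]
  abel

variable [Fintype ι] {ν : Measure (ι → ℂ)} {M : ℝ} {Λ : Matrix ι ι ℂ} {n : ℕ}

lemma posSemidef_outerSq (y : ι → ℂ) : (outerSq y).PosSemidef :=
  posSemidef_vecMulVec_self_star y

lemma re_trace_outerSq_le {y : ι → ℂ} (hy : ∑ j, ‖y j‖ ^ 2 ≤ M ^ 2) :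
    (outerSq y).trace.re ≤ M ^ 2 := by
  refine le_of_eq_of_le ?_ hy
  rw [outerSq, trace_vecMulVec, dotProduct, Complex.re_sum]
  refine Finset.sum_congr rfl fun j _ => ?_
  rw [Pi.star_apply, RCLike.star_def, Complex.mul_conj', ← Complex.ofReal_pow, Complex.ofReal_re]

lemma integral_re_trace_outerSq_mul (hint : ∀ j k, Integrable (fun y => outerSq y j k) ν)
    (hΛ : ∀ j k, Λ j k = ∫ y, outerSq y j k ∂ν) (T : Matrix ι ι ℂ) :
    ∫ y, (outerSq y * T).trace.re ∂ν = (Λ * T).trace.re := by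
  have h1 : ∀ y, (outerSq y * T).trace = ∑ j, ∑ k, outerSq y j k * T k j := fun y => by
    simp [trace, mul_apply]
  have hi : ∀ j k, Integrable (fun y => outerSq y j k * T k j) ν := fun j k =>
    (hint j k).mul_const _
  have hi2 : Integrable (fun y => (outerSq y * T).trace) ν := by
    simp only [h1]
    exact integrable_finsetSum _ fun j _ => integrable_finsetSum _ fun k _ => hi j k
  have h2 : ∫ y, (outerSq y * T).trace.re ∂ν = (∫ y, (outerSq y * T).trace ∂ν).re :=
    integral_re hi2
  rw [h2]
  congr 1
  simp only [h1]
  rw [integral_finsetSum _ fun j _ => integrable_finsetSum _ fun k _ => hi j k]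
  simp only [trace, mul_apply, diag_apply]
  refine Finset.sum_congr rfl fun j _ => ?_
  rw [integral_finsetSum _ fun k _ => hi j k]
  refine Finset.sum_congr rfl fun k _ => ?_
  rw [integral_mul_const, hΛ]

variable [IsProbabilityMeasure ν]

lemma norm_le_of_sum_sq_le {y : ι → ℂ} (hy : ∑ j, ‖y j‖ ^ 2 ≤ M ^ 2) : ‖y‖ ≤ |M| := by
  refine (pi_norm_le_iff_of_nonneg (abs_nonneg M)).2 fun j => ?_
  rw [← abs_norm (y j)]
  exact sq_le_sq.1 ((Finset.single_le_sum (f := fun j => ‖y j‖ ^ 2) (fun j _ => by positivity)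
    (Finset.mem_univ j)).trans hy)

lemma integrable_of_continuous_of_ae_sum_sq_le {F : Type*} [NormedAddCommGroup F]
    (hM : ∀ᵐ y ∂ν, ∑ j, ‖y j‖ ^ 2 ≤ M ^ 2) {f : (ι → ℂ) → F} (hf : Continuous f) :
    Integrable f ν :=
  integrable_of_continuous_of_ae_mem (isCompact_closedBall (0 : ι → ℂ) |M|)
    (hM.mono fun _ hy => by simpa using norm_le_of_sum_sq_le hy) hf

lemma integrable_outerSq_apply (hM : ∀ᵐ y ∂ν, ∑ j, ‖y j‖ ^ 2 ≤ M ^ 2) (j k : ι) :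
    Integrable (fun y => outerSq y j k) ν :=
  integrable_of_continuous_of_ae_sum_sq_le hM (by fun_prop)

lemma integrable_pi_of_continuous
    (hM : ∀ᵐ y ∂ν, ∑ j, ‖y j‖ ^ 2 ≤ M ^ 2) {f : (Fin n → ι → ℂ) → ℝ} (hf : Continuous f) :
    Integrable f (Measure.pi fun _ : Fin n => ν) :=
  integrable_of_continuous_of_ae_mem (isCompact_closedBall (0 : Fin n → ι → ℂ) |M|)
    ((ae_pi_of_ae hM).mono fun _ hx => by
      simpa using (pi_norm_le_iff_of_nonneg (abs_nonneg M)).2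
        fun i => norm_le_of_sum_sq_le (hx i)) hf

lemma integrable_prod_pi_of_continuous
    (hM : ∀ᵐ y ∂ν, ∑ j, ‖y j‖ ^ 2 ≤ M ^ 2) {f : (ι → ℂ) × (Fin n → ι → ℂ) → ℝ}
    (hf : Continuous f) :
    Integrable f (ν.prod (Measure.pi fun _ : Fin n => ν)) :=
  integrable_of_continuous_of_ae_mem
    (isCompact_closedBall (0 : (ι → ℂ) × (Fin n → ι → ℂ)) |M|)
    ((ae_prod_pi_of_ae hM).mono fun z hz => by
      rw [mem_closedBall_zero_iff, Prod.norm_def]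
      exact max_le (norm_le_of_sum_sq_le hz.1)
        ((pi_norm_le_iff_of_nonneg (abs_nonneg M)).2 fun i => norm_le_of_sum_sq_le (hz.2 i))) hf

variable [DecidableEq ι]

lemma outerSq_sq (y : ι → ℂ) : outerSq y ^ 2 = ((∑ j, ‖y j‖ ^ 2 : ℝ) : ℂ) • outerSq y := by
  have : star y ⬝ᵥ y = ((∑ j, ‖y j‖ ^ 2 : ℝ) : ℂ) := by
    simp [dotProduct, ← Complex.conj_mul']
  rw [pow_two, outerSq, vecMulVec_mul_vecMulVec, this]
  ext; simp [vecMulVec_apply]; ring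


/-- The contribution of one sample point, bounded by exchanging it with an independent copy. -/
lemma integral_re_trace_centered_mul_pow_le
    (hM : ∀ᵐ y ∂ν, ∑ j, ‖y j‖ ^ 2 ≤ M ^ 2) (hΛ : ∀ j k, Λ j k = ∫ y, outerSq y j k ∂ν)
    (hΛ' : Λ.IsHermitian) (i : Fin n) (k : ℕ) :
    ∫ x, ((outerSq (x i) - Λ) * centeredSum Λ x ^ (2 * k + 1)).trace.re
        ∂(Measure.pi fun _ : Fin n => ν) ≤
      (2 * k + 1) * M ^ 2 *
        (∫ x, (outerSq (x i) * centeredSum Λ x ^ (2 * k)).trace.re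
            ∂(Measure.pi fun _ : Fin n => ν) +
          ∫ x, (Λ * centeredSum Λ x ^ (2 * k)).trace.re ∂(Measure.pi fun _ : Fin n => ν)) := by
  set π := Measure.pi fun _ : Fin n => ν
  set S : (Fin n → ι → ℂ) → Matrix ι ι ℂ := centeredSum Λ
  have hS : ∀ x, (S x).IsHermitian := isHermitian_centeredSum hΛ'
  have hSc : Continuous S := continuous_centeredSum Λ
  have hint := integrable_outerSq_apply hM
  have hΛT := integral_re_trace_outerSq_mul hint hΛ
  let D : (ι → ℂ) × (Fin n → ι → ℂ) → Matrix ι ι ℂ := fun z => outerSq (z.2 i) - outerSq z.1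
  have hDc : Continuous D := by fun_prop
  have hDe : ∀ z, D (exchange i z) = -D z := fun z => by simp [D, exchange]
  -- `f` integrates to the left-hand side, `g` bounds its antisymmetrisation.
  let f : (ι → ℂ) × (Fin n → ι → ℂ) → ℝ := fun z => (D z * S z.2 ^ (2 * k + 1)).trace.re
  let g : (ι → ℂ) × (Fin n → ι → ℂ) → ℝ := fun z => (D z ^ 2 * S z.2 ^ (2 * k)).trace.re
  have hfc : Continuous f := by fun_prop
  have hgc : Continuous g := by fun_prop
  have hfi := integrable_prod_pi_of_continuous (n := n) hM hfc
  have hgi := integrable_prod_pi_of_continuous (n := n) hM hgc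
  have hfe : Integrable (fun z => f (exchange i z)) (ν.prod π) :=
    integrable_prod_pi_of_continuous (n := n) hM (hfc.comp (continuous_exchange i))
  have hge : Integrable (fun z => g (exchange i z)) (ν.prod π) :=
    integrable_prod_pi_of_continuous (n := n) hM (hgc.comp (continuous_exchange i))
  have split : ∀ (h₁ : (Fin n → ι → ℂ) → ℝ) (T : (Fin n → ι → ℂ) → Matrix ι ι ℂ),
      Continuous h₁ → Continuous T →
      ∫ z, (h₁ z.2 + (outerSq z.1 * T z.2).trace.re) ∂(ν.prod π) =
        ∫ x, h₁ x ∂π + ∫ x, (Λ * T x).trace.re ∂π := by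
    intro h₁ T hh hT
    have c1 : Continuous fun z : (ι → ℂ) × (Fin n → ι → ℂ) => h₁ z.2 := by fun_prop
    have c2 : Continuous fun z : (ι → ℂ) × (Fin n → ι → ℂ) =>
      (outerSq z.1 * T z.2).trace.re := by fun_prop
    have i2 := integrable_prod_pi_of_continuous (n := n) hM c2
    rw [integral_add (integrable_prod_pi_of_continuous hM c1) i2, integral_fun_snd,
      integral_prod_symm _ i2]
    simp [hΛT, π]
  have hf : ∫ z, f z ∂(ν.prod π) =
      ∫ x, ((outerSq (x i) - Λ) * S x ^ (2 * k + 1)).trace.re ∂π := by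
    have e : f = fun z => (outerSq (z.2 i) * S z.2 ^ (2 * k + 1)).trace.re +
        (outerSq z.1 * (-S z.2 ^ (2 * k + 1))).trace.re := by
      funext z; simp [f, D, sub_mul]; ring
    rw [e, split (fun x => (outerSq (x i) * S x ^ (2 * k + 1)).trace.re)
      (fun x => -S x ^ (2 * k + 1)) (by fun_prop) (by fun_prop),
      ← integral_add (integrable_pi_of_continuous hM (by fun_prop))
        (integrable_pi_of_continuous hM (by fun_prop))]
    refine integral_congr_ae (.of_forall fun x => ?_)
    simp [sub_mul]; ring
  have hg : ∫ z, g z ∂(ν.prod π) ≤ 2 * M ^ 2 *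
      (∫ x, (outerSq (x i) * S x ^ (2 * k)).trace.re ∂π +
        ∫ x, (Λ * S x ^ (2 * k)).trace.re ∂π) := by
    rw [← split (fun x => (outerSq (x i) * S x ^ (2 * k)).trace.re) (fun x => S x ^ (2 * k))
      (by fun_prop) (by fun_prop), ← integral_const_mul]
    refine integral_mono_ae hgi (integrable_prod_pi_of_continuous hM (by fun_prop)) ?_
    filter_upwards [ae_prod_pi_of_ae (n := n) hM] with z hz
    have hT := (hS z.2).pow k
    have h1 := (isHermitian_outerSq (z.2 i)).re_trace_sub_sq_mul_sq_le
      (isHermitian_outerSq z.1) hT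
    have h2 : ∀ y : ι → ℂ, ∑ j, ‖y j‖ ^ 2 ≤ M ^ 2 →
        (outerSq y ^ 2 * (S z.2 ^ k) ^ 2).trace.re ≤
          M ^ 2 * (outerSq y * (S z.2 ^ k) ^ 2).trace.re := fun y hy => by
      rw [outerSq_sq, smul_mul, trace_smul, smul_eq_mul, Complex.re_ofReal_mul]
      exact mul_le_mul_of_nonneg_right hy ((posSemidef_outerSq y).re_trace_mul_sq_nonneg hT)
    have h3 := h2 _ hz.1
    have h4 := h2 _ (hz.2 i)
    have e : (S z.2 ^ k) ^ 2 = S z.2 ^ (2 * k) := by rw [← pow_mul, mul_comm]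
    rw [e] at h1 h3 h4
    simp only [g, D]
    linarith
  have hmv : ∀ z, f z + f (exchange i z) ≤ (2 * k + 1) / 2 * (g z + g (exchange i z)) := by
    intro z
    have h := (hS z.2).re_trace_sub_mul_pow_sub_pow_le (hS (exchange i z).2) k
    rw [centeredSum_sub_exchange] at h
    simp only [f, g, hDe, neg_sq]
    refine (le_of_eq ?_).trans h
    simp only [D, mul_sub, trace_sub, neg_mul, trace_neg, Complex.sub_re, Complex.neg_re]
    ring
  have hmono := integral_mono (hfi.add hfe) ((hgi.add hge).const_mul ((2 * k + 1) / 2 : ℝ)) hmv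
  have ef := integral_comp_exchange ν i hfi.aestronglyMeasurable
  have eg := integral_comp_exchange ν i hgi.aestronglyMeasurable
  simp only [Pi.add_apply] at hmono
  rw [integral_add hfi hfe, integral_const_mul, integral_add hgi hge, ef, eg, hf] at hmono
  have hk : (0 : ℝ) ≤ 2 * k + 1 := by positivity
  nlinarith [mul_le_mul_of_nonneg_left hg hk]

/-- The even trace moment of order `2 * (k + 1)`, as the sum of the contributions of the
individual sample points to one of its factors. -/
lemma integral_re_trace_centeredSum_pow_succ
    (hM : ∀ᵐ y ∂ν, ∑ j, ‖y j‖ ^ 2 ≤ M ^ 2) (k : ℕ) :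
    ∫ x, (centeredSum Λ x ^ (2 * k + 2)).trace.re ∂(Measure.pi fun _ : Fin n => ν) =
      ∑ i, ∫ x, ((outerSq (x i) - Λ) * centeredSum Λ x ^ (2 * k + 1)).trace.re
        ∂(Measure.pi fun _ : Fin n => ν) := by
  rw [← integral_finsetSum _ fun i _ => integrable_pi_of_continuous hM (by fun_prop)]
  refine integral_congr_ae (.of_forall fun x => ?_)
  have h : centeredSum Λ x = ∑ i, (outerSq (x i) - Λ) := by
    simp [centeredSum, Finset.sum_sub_distrib, Nat.cast_smul_eq_nsmul]
  simp only
  rw [show 2 * k + 2 = 2 * k + 1 + 1 by ring, pow_succ' _ (2 * k + 1)]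
  nth_rw 1 [h]
  rw [Finset.sum_mul, trace_sum, Complex.re_sum]

/-- The second trace moment. Its bound is independent of the dimension since
`tr Λ = E ‖y‖ ^ 2 ≤ M ^ 2`. -/
lemma integral_re_trace_centeredSum_sq_le
    (hM : ∀ᵐ y ∂ν, ∑ j, ‖y j‖ ^ 2 ≤ M ^ 2) (hΛ : ∀ j k, Λ j k = ∫ y, outerSq y j k ∂ν)
    (hΛ' : Λ.IsHermitian) :
    ∫ x, (centeredSum Λ x ^ 2).trace.re ∂(Measure.pi fun _ : Fin n => ν) ≤
      2 * n * M ^ 2 * M ^ 2 := by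
  have h1 := integral_re_trace_centeredSum_pow_succ (Λ := Λ) (n := n) hM 0
  rw [mul_zero, zero_add] at h1
  rw [h1]
  have htr : Λ.trace.re ≤ M ^ 2 := by
    have h := integral_re_trace_outerSq_mul (integrable_outerSq_apply hM) hΛ 1
    simp only [mul_one] at h
    rw [← h]
    calc ∫ y, (outerSq y).trace.re ∂ν ≤ ∫ _, M ^ 2 ∂ν :=
          integral_mono_ae (integrable_of_continuous_of_ae_sum_sq_le hM (by fun_prop))
            (integrable_const _) (hM.mono fun y hy => re_trace_outerSq_le hy)
      _ = M ^ 2 := by simp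
  have hi : ∀ i : Fin n, ∫ x, ((outerSq (x i) - Λ) * centeredSum Λ x ^ (2 * 0 + 1)).trace.re
      ∂(Measure.pi fun _ : Fin n => ν) ≤ 2 * M ^ 2 * M ^ 2 := by
    intro i
    refine (integral_re_trace_centered_mul_pow_le hM hΛ hΛ' i 0).trans ?_
    have h2 : ∫ x, (outerSq (x i)).trace.re ∂(Measure.pi fun _ : Fin n => ν) ≤ M ^ 2 :=
      calc _ ≤ ∫ _, M ^ 2 ∂(Measure.pi fun _ : Fin n => ν) :=
            integral_mono_ae (integrable_pi_of_continuous hM (by fun_prop))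
              (integrable_const _)
              ((ae_pi_of_ae hM).mono fun x hx => re_trace_outerSq_le (hx i))
        _ = M ^ 2 := by simp
    simp only [mul_zero, pow_zero, mul_one, integral_const, probReal_univ, smul_eq_mul, one_mul,
      Nat.cast_zero, zero_add]
    nlinarith [sq_nonneg M]
  refine (Finset.sum_le_sum fun i _ => hi i).trans (le_of_eq ?_)
  simp; ring

/-- The recursion between consecutive even trace moments. -/
lemma integral_re_trace_centeredSum_pow_succ_le (hM0 : 0 < M)
    (hM : ∀ᵐ y ∂ν, ∑ j, ‖y j‖ ^ 2 ≤ M ^ 2) (hΛ : ∀ j k, Λ j k = ∫ y, outerSq y j k ∂ν)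
    (hΛ1 : (1 - Λ).PosSemidef) (hΛ' : Λ.IsHermitian) (k : ℕ) {v : ℝ}
    (hv : v = (2 * k + 1) * M ^ 2) :
    ∫ x, (centeredSum Λ x ^ (2 * k + 2)).trace.re ∂(Measure.pi fun _ : Fin n => ν) ≤
      4 / 3 * (v ^ 2 + 2 * n * v) *
        ∫ x, (centeredSum Λ x ^ (2 * k)).trace.re ∂(Measure.pi fun _ : Fin n => ν) := by
  set π := Measure.pi fun _ : Fin n => ν
  set S : (Fin n → ι → ℂ) → Matrix ι ι ℂ := centeredSum Λ with hSdef
  have hS : ∀ x, (S x).IsHermitian := isHermitian_centeredSum hΛ'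
  have hSc : Continuous S := continuous_centeredSum Λ
  have hv0 : 0 < v := by rw [hv]; positivity
  have h1 : ∫ x, (S x ^ (2 * k + 2)).trace.re ∂π ≤
      v * (∫ x, (S x ^ (2 * k + 1)).trace.re ∂π +
        2 * n * ∫ x, (Λ * S x ^ (2 * k)).trace.re ∂π) := by
    rw [integral_re_trace_centeredSum_pow_succ hM]
    refine (Finset.sum_le_sum fun i _ =>
      integral_re_trace_centered_mul_pow_le hM hΛ hΛ' i k).trans (le_of_eq ?_)
    rw [← Finset.mul_sum, Finset.sum_add_distrib, ← hv,
      ← integral_finsetSum _ fun i _ => integrable_pi_of_continuous hM (by fun_prop)]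
    have e : ∀ x : Fin n → ι → ℂ, ∑ i, (outerSq (x i) * S x ^ (2 * k)).trace.re =
        (S x ^ (2 * k + 1)).trace.re + n * (Λ * S x ^ (2 * k)).trace.re := by
      intro x
      have h : ∑ i, outerSq (x i) = S x + (n : ℂ) • Λ := by simp [hSdef, centeredSum]
      rw [← Complex.re_sum, ← trace_sum, ← Finset.sum_mul, h, add_mul, ← pow_succ', smul_mul,
        trace_add, trace_smul]
      simp
    simp only [← hSdef, e]
    rw [integral_add (integrable_pi_of_continuous hM (by fun_prop))
      (integrable_pi_of_continuous hM (by fun_prop)), integral_const_mul, Finset.sum_const,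
      Finset.card_univ, Fintype.card_fin, nsmul_eq_mul]
    simp only [π]
    ring
  have h2 : ∫ x, (Λ * S x ^ (2 * k)).trace.re ∂π ≤ ∫ x, (S x ^ (2 * k)).trace.re ∂π := by
    refine integral_mono (integrable_pi_of_continuous hM (by fun_prop))
      (integrable_pi_of_continuous hM (by fun_prop)) fun x => ?_
    have h := hΛ1.re_trace_mul_sq_nonneg ((hS x).pow k)
    rw [← pow_mul, mul_comm k 2, sub_mul, one_mul, trace_sub, Complex.sub_re] at h
    exact sub_nonneg.1 h
  -- With this weight, Young's inequality leaves a quarter of the moment to be absorbed.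
  have h3 : ∫ x, (S x ^ (2 * k + 1)).trace.re ∂π ≤
      1 / (4 * v) * ∫ x, (S x ^ (2 * k + 2)).trace.re ∂π +
        v * ∫ x, (S x ^ (2 * k)).trace.re ∂π := by
    rw [← integral_const_mul, ← integral_const_mul,
      ← integral_add (integrable_pi_of_continuous hM (by fun_prop))
        (integrable_pi_of_continuous hM (by fun_prop))]
    refine integral_mono (integrable_pi_of_continuous hM (by fun_prop))
      (integrable_pi_of_continuous hM (by fun_prop)) fun x => ?_
    refine ((hS x).re_trace_pow_odd_le k (c := 1 / (2 * v)) (by positivity)).trans (le_of_eq ?_)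
    field_simp
    ring
  have h4 : v * (1 / (4 * v) * ∫ x, (S x ^ (2 * k + 2)).trace.re ∂π) =
      1 / 4 * ∫ x, (S x ^ (2 * k + 2)).trace.re ∂π := by field_simp
  have h5 := mul_le_mul_of_nonneg_left h3 hv0.le
  have h6 := mul_le_mul_of_nonneg_left h2 (show 0 ≤ v * (2 * n) by positivity)
  nlinarith

lemma integral_re_trace_centeredSum_pow_le (hM0 : 0 < M)
    (hM : ∀ᵐ y ∂ν, ∑ j, ‖y j‖ ^ 2 ≤ M ^ 2) (hΛ : ∀ j k, Λ j k = ∫ y, outerSq y j k ∂ν)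
    (hΛ1 : (1 - Λ).PosSemidef) (hΛ' : Λ.IsHermitian) {p : ℕ} (hp : 1 ≤ p) {v : ℝ}
    (hv : 2 * p * M ^ 2 ≤ v) :
    ∫ x, (centeredSum Λ x ^ (2 * p)).trace.re ∂(Measure.pi fun _ : Fin n => ν) ≤
      M ^ 2 * (4 / 3 * (v ^ 2 + 2 * n * v)) ^ p := by
  have hv0 : 0 ≤ v := le_trans (by positivity) hv
  induction p, hp using Nat.le_induction with
  | base =>
    refine (integral_re_trace_centeredSum_sq_le hM hΛ hΛ').trans ?_
    push_cast at hv
    rw [pow_one, mul_comm]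
    have : M ^ 2 ≤ v := by nlinarith [sq_nonneg M]
    refine mul_le_mul_of_nonneg_left ?_ (sq_nonneg M)
    nlinarith [mul_le_mul_of_nonneg_left this (show (0 : ℝ) ≤ 2 * n by positivity),
      mul_nonneg (show (0 : ℝ) ≤ n by positivity) hv0, sq_nonneg v]
  | succ p hp ih =>
    push_cast at hv
    have hw : (2 * p + 1) * M ^ 2 ≤ v := by nlinarith [sq_nonneg M]
    have h := integral_re_trace_centeredSum_pow_succ_le (n := n) hM0 hM hΛ hΛ1 hΛ' p rfl
    refine h.trans ?_
    rw [pow_succ' _ p, mul_left_comm (M ^ 2)]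
    refine mul_le_mul ?_ (ih (by nlinarith [sq_nonneg M])) ?_ (by positivity)
    · gcongr
    · refine integral_nonneg fun x => ?_
      rw [(isHermitian_centeredSum hΛ' x).re_trace_pow]
      exact Finset.sum_nonneg fun i _ => (even_two_mul p).pow_nonneg _

end Moments

/-! ### Finite sections of operators on `ℓ₂` -/

section FiniteSections

open Matrix Filter Topology
open scoped ComplexOrder

/-- The `k`-th standard unit vector of `ℓ₂`. -/
noncomputable def stdVec (k : ℕ) : ℓ²(ℕ, ℂ) := lp.single 2 k (1 : ℂ)

/-- The embedding of `ℂ ^ d` into `ℓ₂` as the sequences supported in the first `d` places. -/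
noncomputable def embed {d : ℕ} (u : Fin d → ℂ) : ℓ²(ℕ, ℂ) := ∑ k, u k • stdVec k

/-- The upper left `d × d` section of the matrix of an operator on `ℓ₂`. -/
noncomputable def finiteSection (d : ℕ) :
    (ℓ²(ℕ, ℂ) →L[ℂ] ℓ²(ℕ, ℂ)) →ₗ[ℂ] Matrix (Fin d) (Fin d) ℂ where
  toFun T := Matrix.of fun j k => T (stdVec k) j
  map_add' _ _ := by ext; simp
  map_smul' _ _ := by ext; simp

lemma finiteSection_apply (d : ℕ) (T : ℓ²(ℕ, ℂ) →L[ℂ] ℓ²(ℕ, ℂ)) (j k : Fin d) :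
    finiteSection d T j k = T (stdVec k) j := rfl

lemma inner_stdVec_left (k : ℕ) (f : ℓ²(ℕ, ℂ)) : inner ℂ (stdVec k) f = f k := by
  simp [stdVec, lp.inner_single_left]

lemma smul_stdVec (k : ℕ) (a : ℂ) : a • stdVec k = lp.single 2 k a := by
  rw [stdVec, ← lp.single_smul]; simp

lemma sum_smul_stdVec_eq_embed (f : ℓ²(ℕ, ℂ)) (d : ℕ) :
    ∑ k ∈ Finset.range d, lp.single 2 k (f k) = embed (fun k : Fin d => f k) := by
  rw [embed, Finset.sum_range]
  simp only [smul_stdVec]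

lemma tendsto_embed (f : ℓ²(ℕ, ℂ)) :
    Tendsto (fun d => embed (fun k : Fin d => f k)) atTop (𝓝 f) := by
  simp only [← sum_smul_stdVec_eq_embed]
  exact (lp.hasSum_single (by simp) f).tendsto_sum_nat

lemma norm_embed {d : ℕ} (u : Fin d → ℂ) : ‖embed u‖ = ‖WithLp.toLp 2 u‖ := by
  have h : (inner ℂ (embed u) (embed u) : ℂ) = inner ℂ (WithLp.toLp 2 u) (WithLp.toLp 2 u) := by
    have hc : ∀ j : Fin d, inner ℂ (stdVec j) (embed u) = u j := by
      intro j
      simp only [embed, inner_sum, inner_smul_right, inner_stdVec_left]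
      simp [stdVec, lp.single_apply, Pi.single_apply, Fin.val_inj]
    nth_rewrite 1 [embed]
    rw [sum_inner, PiLp.inner_apply]
    simp [inner_smul_left, hc, Complex.conj_mul']
  rw [inner_self_eq_norm_sq_to_K, inner_self_eq_norm_sq_to_K] at h
  have h' : ‖embed u‖ ^ 2 = ‖WithLp.toLp 2 u‖ ^ 2 := by exact_mod_cast h
  exact (pow_left_inj₀ (norm_nonneg _) (norm_nonneg _) two_ne_zero).1 h'

lemma inner_embed {d : ℕ} (T : ℓ²(ℕ, ℂ) →L[ℂ] ℓ²(ℕ, ℂ)) (u w : Fin d → ℂ) :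
    inner ℂ (embed u) (T (embed w)) = star u ⬝ᵥ (finiteSection d T *ᵥ w) := by
  simp only [embed, map_sum, map_smul, sum_inner, inner_sum, inner_smul_left, inner_smul_right,
    inner_stdVec_left, dotProduct, mulVec, finiteSection_apply, Finset.mul_sum, Pi.star_apply,
    RCLike.star_def]
  rw [Finset.sum_comm]
  exact Finset.sum_congr rfl fun j _ => Finset.sum_congr rfl fun k _ => by ring

lemma norm_inner_embed_le {d : ℕ} (T : ℓ²(ℕ, ℂ) →L[ℂ] ℓ²(ℕ, ℂ)) (u w : Fin d → ℂ) :
    ‖(inner ℂ (embed u) (T (embed w)) : ℂ)‖ ≤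
      ‖embed u‖ * (‖toEuclideanCLM (𝕜 := ℂ) (finiteSection d T)‖ * ‖embed w‖) := by
  have h : (inner ℂ (embed u) (T (embed w)) : ℂ) = inner ℂ (WithLp.toLp 2 u)
      (toEuclideanCLM (𝕜 := ℂ) (finiteSection d T) (WithLp.toLp 2 w)) := by
    rw [inner_embed, toEuclideanCLM_toLp, EuclideanSpace.inner_toLp_toLp, dotProduct_comm]
  rw [h, norm_embed, norm_embed]
  exact (norm_inner_le_norm _ _).trans
    (mul_le_mul_of_nonneg_left (ContinuousLinearMap.le_opNorm _ _) (norm_nonneg _))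

lemma norm_sq_embed_le (f : ℓ²(ℕ, ℂ)) (d : ℕ) :
    ‖embed (fun k : Fin d => f k)‖ ^ 2 ≤ ‖f‖ ^ 2 := by
  rw [norm_embed, EuclideanSpace.norm_sq_eq]
  have h := lp.sum_rpow_le_norm_rpow (p := 2) (by simp) f (Finset.range d)
  simp only [ENNReal.toReal_ofNat, Real.rpow_ofNat] at h
  rwa [Finset.sum_range] at h

/-- The norm of an operator on `ℓ₂` is at most the lower limit of the norms of its finite
sections. -/
lemma eventually_lt_norm_finiteSection {T : ℓ²(ℕ, ℂ) →L[ℂ] ℓ²(ℕ, ℂ)} {s : ℝ} (hs : 0 ≤ s)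
    (hT : s < ‖T‖) :
    ∀ᶠ d in atTop, s < ‖toEuclideanCLM (𝕜 := ℂ) (finiteSection d T)‖ := by
  obtain ⟨w, hw⟩ : ∃ w, s * ‖w‖ < ‖T w‖ := by
    by_contra! h
    exact hT.not_ge (T.opNorm_le_bound hs h)
  have hTw : 0 < ‖T w‖ := lt_of_le_of_lt (by positivity) hw
  have hlim : Tendsto (fun d => ‖(inner ℂ (embed fun k : Fin d => T w k)
      (T (embed fun k : Fin d => w k)) : ℂ)‖) atTop (𝓝 (‖T w‖ ^ 2)) := by
    have h := ((tendsto_embed (T w)).inner (𝕜 := ℂ)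
      ((T.continuous.tendsto w).comp (tendsto_embed w))).norm
    rw [inner_self_eq_norm_sq_to_K] at h
    simpa using h
  have hlt : ‖T w‖ * (s * ‖w‖) < ‖T w‖ ^ 2 := by rw [pow_two]; gcongr
  filter_upwards [hlim.eventually_const_lt hlt] with d hd
  have hnorm : ∀ f : ℓ²(ℕ, ℂ), ‖embed (fun k : Fin d => f k)‖ ≤ ‖f‖ := fun f =>
    (pow_le_pow_iff_left₀ (norm_nonneg _) (norm_nonneg _) two_ne_zero).1 (norm_sq_embed_le f d)
  have h1 := hd.trans_le (norm_inner_embed_le T _ _)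
  by_contra! hle
  refine h1.not_ge ?_
  gcongr
  · exact hnorm _
  · exact hnorm _

lemma finiteSection_selfTensor (d : ℕ) (y : ℓ²(ℕ, ℂ)) :
    finiteSection d (selfTensor y) = outerSq (fun k : Fin d => y k) := by
  ext j k
  have h : inner ℂ y (stdVec k) = star (y k) := by
    rw [← inner_conj_symm, inner_stdVec_left]; rfl
  simp [finiteSection_apply, selfTensor, outerSq, vecMulVec_apply, h, mul_comm]

/-- A matrix entry as a continuous linear functional of the operator. -/
noncomputable def entryCLM (j k : ℕ) : (ℓ²(ℕ, ℂ) →L[ℂ] ℓ²(ℕ, ℂ)) →L[ℂ] ℂ :=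
  (innerSL ℂ (stdVec j)).comp (ContinuousLinearMap.apply ℂ ℓ²(ℕ, ℂ) (stdVec k))

lemma entryCLM_apply (j k : ℕ) (T : ℓ²(ℕ, ℂ) →L[ℂ] ℓ²(ℕ, ℂ)) :
    entryCLM j k T = T (stdVec k) j := by
  simp [entryCLM, inner_stdVec_left]

lemma posSemidef_one_sub_finiteSection {T : ℓ²(ℕ, ℂ) →L[ℂ] ℓ²(ℕ, ℂ)} (hT : ‖T‖ ≤ 1) {d : ℕ}
    (hsym : (finiteSection d T).IsHermitian) : (1 - finiteSection d T).PosSemidef := by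
  have hH : (1 - finiteSection d T).IsHermitian := isHermitian_one.sub hsym
  refine .of_dotProduct_mulVec_nonneg hH fun u => ?_
  rw [Complex.nonneg_iff]
  refine ⟨?_, (hH.im_star_dotProduct_mulVec_self u).symm⟩
  have h1 : star u ⬝ᵥ u = ((‖embed u‖ ^ 2 : ℝ) : ℂ) := by
    rw [norm_embed, dotProduct_comm, ← EuclideanSpace.inner_toLp_toLp, inner_self_eq_norm_sq_to_K]
    simp
  rw [sub_mulVec, one_mulVec, dotProduct_sub, ← inner_embed, h1, Complex.sub_re,
    Complex.ofReal_re, sub_nonneg]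
  refine (Complex.re_le_norm _).trans ((norm_inner_le_norm _ _).trans ?_)
  have := T.le_of_opNorm_le hT (embed u)
  nlinarith [norm_nonneg (embed u)]

/-- By separability, measurable maps into `ℓ₂` are strongly measurable, so that the expectation of
`selfTensor (y i)` is a genuine Bochner integral. -/
instance separableSpace_ellTwo : TopologicalSpace.SeparableSpace ℓ²(ℕ, ℂ) := by
  have h : TopologicalSpace.IsSeparable
      (closure (Submodule.span ℂ (Set.range stdVec) : Set ℓ²(ℕ, ℂ))) :=
    ((Set.countable_range stdVec).isSeparable.span (R := ℂ)).closure
  refine TopologicalSpace.isSeparable_univ_iff.1 (h.mono fun f _ => ?_)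
  refine mem_closure_of_tendsto (tendsto_embed f) (.of_forall fun d => ?_)
  exact Submodule.sum_mem _ fun k _ =>
    Submodule.smul_mem _ _ (Submodule.subset_span ⟨k, rfl⟩)

lemma continuous_selfTensor : Continuous selfTensor :=
  ((ContinuousLinearMap.smulRightL ℂ ℓ²(ℕ, ℂ) ℓ²(ℕ, ℂ)).continuous.comp
    (innerSL ℂ).continuous).clm_apply continuous_id

lemma norm_selfTensor (y : ℓ²(ℕ, ℂ)) : ‖selfTensor y‖ = ‖y‖ ^ 2 := by
  simp [selfTensor, pow_two]

end FiniteSections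

/-! ### The tail bound -/

section Tail

open MeasureTheory ProbabilityTheory Matrix Filter Topology

/-- If the moment order `p` is the integer part of the exponent `L`, the base of the moment bound
is at most `(n * t) ^ 2 / e`. -/
lemma moment_bound_le {n M t L : ℝ} (hn : 0 < n) (ht : 0 < t) (ht1 : t ≤ 1)
    (hL : 21 * M ^ 2 * L = t ^ 2 * n) (hL1 : 1 ≤ L) :
    M ^ 2 * (4 / 3 * ((2 * ⌊L⌋₊ * M ^ 2) ^ 2 + 2 * n * (2 * ⌊L⌋₊ * M ^ 2))) ^ ⌊L⌋₊ ≤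
      n * Real.exp (-L) * (n * t) ^ (2 * ⌊L⌋₊) := by
  set p := ⌊L⌋₊
  have hp : (p : ℝ) ≤ L := Nat.floor_le (by linarith)
  have hp' : L - 1 ≤ p := (Nat.sub_one_lt_floor L).le
  set v := 2 * p * M ^ 2
  have hv0 : 0 ≤ v := by positivity
  have hv : v ≤ 2 / 21 * (n * t ^ 2) := by
    have : p * M ^ 2 ≤ L * M ^ 2 := by gcongr
    simp only [v]; nlinarith
  have he := Real.exp_one_lt_d9
  have hbase : 4 / 3 * (v ^ 2 + 2 * n * v) ≤ (n * t) ^ 2 * Real.exp (-1) := by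
    have h1 : v ^ 2 ≤ (2 / 21 * (n * t ^ 2)) ^ 2 := by gcongr
    have h2 : (n * t ^ 2) ^ 2 ≤ (n * t) ^ 2 := by
      have : n * t ^ 2 ≤ n * t := by gcongr; nlinarith
      gcongr
    have h3 : 2 * n * v ≤ 2 * n * (2 / 21 * (n * t ^ 2)) := by gcongr
    have h4 : 1 / 3 ≤ Real.exp (-1) := by
      rw [Real.exp_neg, ← one_div]
      exact one_div_le_one_div_of_le (Real.exp_pos 1) (by linarith)
    nlinarith [mul_le_mul_of_nonneg_left h4 (sq_nonneg (n * t)), sq_nonneg (n * t)]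
  have hpow : (4 / 3 * (v ^ 2 + 2 * n * v)) ^ p ≤
      (n * t) ^ (2 * p) * Real.exp (1 - L) := by
    calc _ ≤ ((n * t) ^ 2 * Real.exp (-1)) ^ p := by gcongr
      _ = (n * t) ^ (2 * p) * Real.exp (-p) := by
        rw [mul_pow, ← pow_mul, ← Real.exp_nat_mul]; ring_nf
      _ ≤ _ := by gcongr; linarith
  have hM : M ^ 2 * Real.exp 1 ≤ n := by
    have h1 : 21 * M ^ 2 ≤ n := by
      have : t ^ 2 * n ≤ 1 * n := by gcongr; nlinarith
      nlinarith [mul_le_mul_of_nonneg_left hL1 (sq_nonneg M)]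
    nlinarith [mul_le_mul_of_nonneg_left he.le (sq_nonneg M), sq_nonneg M]
  calc _ ≤ M ^ 2 * ((n * t) ^ (2 * p) * Real.exp (1 - L)) := by gcongr
    _ = M ^ 2 * Real.exp 1 * Real.exp (-L) * (n * t) ^ (2 * p) := by
      rw [sub_eq_add_neg, Real.exp_add]; ring
    _ ≤ _ := by gcongr

variable {Ω : Type*} [MeasurableSpace Ω] {P : Measure Ω} [IsProbabilityMeasure P] {n : ℕ} {M : ℝ}
  {y : Fin n → Ω → ℓ²(ℕ, ℂ)} {Λ : ℓ²(ℕ, ℂ) →L[ℂ] ℓ²(ℕ, ℂ)}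

lemma measurable_restrict (d : ℕ) :
    Measurable fun (f : ℓ²(ℕ, ℂ)) (k : Fin d) => f k :=
  (continuous_pi fun k : Fin d => (lp.lipschitzWith_one_eval 2 (k : ℕ)).continuous).measurable

lemma integrable_selfTensor {f : Ω → ℓ²(ℕ, ℂ)} (hf : Measurable f)
    (hM : ∀ᵐ ω ∂P, ‖f ω‖ ≤ M) : Integrable (fun ω => selfTensor (f ω)) P := by
  have : SecondCountableTopology ℓ²(ℕ, ℂ) := UniformSpace.secondCountable_of_separable _
  refine Integrable.of_bound
    (continuous_selfTensor.comp_aestronglyMeasurable hf.aestronglyMeasurable) (M ^ 2) ?_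
  filter_upwards [hM] with ω hω
  rw [norm_selfTensor]
  gcongr

/-- The tail bound by moments for a finite section of the deviation. -/
lemma measureReal_norm_finiteSection_le (hn : n ≠ 0) (hM : 0 < M)
    (hmeas : ∀ i, Measurable (y i)) (hindep : iIndepFun y P)
    (hident : ∀ i j, IdentDistrib (y i) (y j) P P) (hbound : ∀ i, ∀ᵐ ω ∂P, ‖y i ω‖ ≤ M)
    (hΛ : ∀ i, Λ = ∫ ω, selfTensor (y i ω) ∂P) (hΛ_norm : ‖Λ‖ ≤ 1) (d : ℕ) {p : ℕ} (hp : 1 ≤ p)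
    {s : ℝ} (hs : 0 < s) :
    P.real {ω | s < ‖toEuclideanCLM (𝕜 := ℂ)
        (finiteSection d ((1 / (n : ℂ)) • (∑ i, selfTensor (y i ω)) - Λ))‖} * (n * s) ^ (2 * p) ≤
      M ^ 2 * (4 / 3 * ((2 * p * M ^ 2) ^ 2 + 2 * n * (2 * p * M ^ 2))) ^ p := by
  have hn0 : (0 : ℝ) < n := by positivity
  let i₀ : Fin n := ⟨0, Nat.pos_of_ne_zero hn⟩
  let r : ℓ²(ℕ, ℂ) → Fin d → ℂ := fun f k => f k
  have hr : Measurable r := measurable_restrict d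
  let x : Ω → Fin n → Fin d → ℂ := fun ω i => r (y i ω)
  have hxi : ∀ i, Measurable fun ω => r (y i ω) := fun i => hr.comp (hmeas i)
  have hx : Measurable x := measurable_pi_lambda _ hxi
  set ν := P.map fun ω => r (y i₀ ω)
  have : IsProbabilityMeasure ν := Measure.isProbabilityMeasure_map (hxi i₀).aemeasurable
  have hmap : P.map x = Measure.pi fun _ : Fin n => ν := by
    rw [(iIndepFun_iff_map_fun_eq_pi_map fun i => (hxi i).aemeasurable).1
      (hindep.comp (fun _ => r) fun _ => hr)]
    congr 1
    funext i
    exact ((hident i i₀).comp hr).map_eq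
  have hνM : ∀ᵐ z ∂ν, ∑ k, ‖z k‖ ^ 2 ≤ M ^ 2 := by
    rw [ae_map_iff (hxi i₀).aemeasurable (measurableSet_le (by fun_prop) (by fun_prop))]
    filter_upwards [hbound i₀] with ω hω
    have h := norm_sq_embed_le (y i₀ ω) d
    rw [norm_embed, EuclideanSpace.norm_sq_eq] at h
    exact h.trans (by gcongr)
  have hΛd : ∀ j k, finiteSection d Λ j k = ∫ z, outerSq z j k ∂ν := by
    intro j k
    have hc : Continuous fun z : Fin d → ℂ => outerSq z j k := by fun_prop
    rw [integral_map (hxi i₀).aemeasurable hc.aestronglyMeasurable]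
    have h := (entryCLM j k).integral_comp_comm (integrable_selfTensor (hmeas i₀) (hbound i₀))
    rw [← hΛ i₀, entryCLM_apply] at h
    refine h.symm.trans (integral_congr_ae (.of_forall fun ω => ?_))
    change entryCLM j k (selfTensor (y i₀ ω)) = outerSq (fun k : Fin d => y i₀ ω k) j k
    rw [entryCLM_apply, ← finiteSection_selfTensor]
    rfl
  have hΛH : (finiteSection d Λ).IsHermitian := by
    ext j k
    rw [conjTranspose_apply, hΛd, hΛd, RCLike.star_def, ← integral_conj]
    exact integral_congr_ae (.of_forall fun z => (isHermitian_outerSq z).apply j k)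
  have hsec : ∀ ω, finiteSection d ((1 / (n : ℂ)) • (∑ i, selfTensor (y i ω)) - Λ) =
      (1 / (n : ℂ)) • centeredSum (finiteSection d Λ) (x ω) := by
    intro ω
    rw [map_sub, map_smul, map_sum, centeredSum, smul_sub, smul_smul,
      one_div_mul_cancel (by exact_mod_cast hn), one_smul]
    simp only [finiteSection_selfTensor]
    rfl
  set S := fun ω => centeredSum (finiteSection d Λ) (x ω)
  have hS : ∀ ω, (S ω).IsHermitian := fun ω => isHermitian_centeredSum hΛH _
  have hc : Continuous fun z : Fin n → Fin d → ℂ =>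
      (centeredSum (finiteSection d Λ) z ^ (2 * p)).trace.re := by fun_prop
  have hint : Integrable (fun ω => (S ω ^ (2 * p)).trace.re) P := by
    have h := integrable_pi_of_continuous (n := n) hνM hc
    rw [← hmap] at h
    exact h.comp_measurable hx
  have hmom : ∫ ω, (S ω ^ (2 * p)).trace.re ∂P ≤
      M ^ 2 * (4 / 3 * ((2 * p * M ^ 2) ^ 2 + 2 * n * (2 * p * M ^ 2))) ^ p := by
    rw [← integral_map (f := fun z => (centeredSum (finiteSection d Λ) z ^ (2 * p)).trace.re)
      hx.aemeasurable hc.aestronglyMeasurable, hmap]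
    exact integral_re_trace_centeredSum_pow_le hM hνM hΛd
      (posSemidef_one_sub_finiteSection hΛ_norm hΛH) hΛH hp le_rfl
  have hmarkov := mul_meas_ge_le_integral_of_nonneg
    (.of_forall fun ω => (pow_nonneg (norm_nonneg _) _).trans
      ((hS ω).norm_toEuclideanCLM_pow_le (p := p) (by omega))) hint ((n * s) ^ (2 * p))
  rw [mul_comm]
  refine le_trans ?_ (hmarkov.trans hmom)
  refine mul_le_mul_of_nonneg_left (measureReal_mono fun ω hω => ?_) (by positivity)
  rw [Set.mem_ofPred_eq, hsec, map_smul, norm_smul, norm_div, norm_one, Complex.norm_natCast,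
    one_div, lt_inv_mul_iff₀ hn0] at hω
  exact (pow_le_pow_left₀ (by positivity) hω.le _).trans
    ((hS ω).norm_toEuclideanCLM_pow_le (by omega))

/-- The tail bound by moments for the deviation itself. -/
lemma measureReal_norm_deviation_le (hn : n ≠ 0) (hM : 0 < M)
    (hmeas : ∀ i, Measurable (y i)) (hindep : iIndepFun y P)
    (hident : ∀ i j, IdentDistrib (y i) (y j) P P) (hbound : ∀ i, ∀ᵐ ω ∂P, ‖y i ω‖ ≤ M)
    (hΛ : ∀ i, Λ = ∫ ω, selfTensor (y i ω) ∂P) (hΛ_norm : ‖Λ‖ ≤ 1) {p : ℕ} (hp : 1 ≤ p)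
    {t : ℝ} (ht : 0 < t) :
    P.real {ω | t ≤ ‖(1 / (n : ℂ)) • (∑ i, selfTensor (y i ω)) - Λ‖} * (n * t) ^ (2 * p) ≤
      M ^ 2 * (4 / 3 * ((2 * p * M ^ 2) ^ 2 + 2 * n * (2 * p * M ^ 2))) ^ p := by
  set B := M ^ 2 * (4 / 3 * ((2 * p * M ^ 2) ^ 2 + 2 * n * (2 * p * M ^ 2))) ^ p
  have hn0 : (0 : ℝ) < n := by positivity
  -- The sections only see levels strictly below the norm, whence the passage to `s < t`.
  have hlt : ∀ s ∈ Set.Ioo 0 t,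
      P.real {ω | t ≤ ‖(1 / (n : ℂ)) • (∑ i, selfTensor (y i ω)) - Λ‖} * (n * s) ^ (2 * p) ≤ B := by
    rintro s ⟨hs, hst⟩
    let D : ℕ → Set Ω := fun d => {ω | s < ‖toEuclideanCLM (𝕜 := ℂ)
      (finiteSection d ((1 / (n : ℂ)) • (∑ i, selfTensor (y i ω)) - Λ))‖}
    have hD : ∀ d, P (D d) ≤ ENNReal.ofReal (B / (n * s) ^ (2 * p)) := by
      intro d
      rw [← ENNReal.ofReal_toReal (measure_ne_top P (D d))]
      refine ENNReal.ofReal_le_ofReal ((le_div_iff₀ (by positivity)).2 ?_)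
      exact measureReal_norm_finiteSection_le hn hM hmeas hindep hident hbound hΛ hΛ_norm d hp hs
    have hmono : Monotone fun N => ⋂ d ≥ N, D d := fun N N' h =>
      Set.biInter_subset_biInter_left fun d (hd : N' ≤ d) => h.trans hd
    have hsub : {ω | t ≤ ‖(1 / (n : ℂ)) • (∑ i, selfTensor (y i ω)) - Λ‖} ⊆
        ⋃ N, ⋂ d ≥ N, D d := by
      intro ω hω
      obtain ⟨N, hN⟩ := eventually_atTop.1
        (eventually_lt_norm_finiteSection hs.le (hst.trans_le hω))
      exact Set.mem_iUnion.2 ⟨N, Set.mem_iInter₂.2 hN⟩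
    have hP : P {ω | t ≤ ‖(1 / (n : ℂ)) • (∑ i, selfTensor (y i ω)) - Λ‖} ≤
        ENNReal.ofReal (B / (n * s) ^ (2 * p)) := by
      refine (measure_mono hsub).trans ?_
      rw [hmono.measure_iUnion]
      exact iSup_le fun N => (measure_mono (Set.biInter_subset_of_mem le_rfl)).trans (hD N)
    exact (le_div_iff₀ (by positivity)).1
      (ENNReal.toReal_le_of_le_ofReal (by positivity) hP)
  have hlim : Tendsto (fun s => P.real {ω | t ≤ ‖(1 / (n : ℂ)) •
      (∑ i, selfTensor (y i ω)) - Λ‖} * (n * s) ^ (2 * p)) (𝓝[<] t)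
      (𝓝 (P.real {ω | t ≤ ‖(1 / (n : ℂ)) • (∑ i, selfTensor (y i ω)) - Λ‖} *
        (n * t) ^ (2 * p))) :=
    (Continuous.tendsto (by fun_prop) t).mono_left nhdsWithin_le_nhds
  exact le_of_tendsto hlim (mem_of_superset (Ioo_mem_nhdsLT ht) hlt)

end Tail

theorem theorem1p1 {Ω : Type*} [MeasurableSpace Ω]
    (P : MeasureTheory.Measure Ω) [MeasureTheory.IsProbabilityMeasure P]
    (n : ℕ) (hn : 3 ≤ n) (M : ℝ) (hM : 0 < M)
    (y : Fin n → Ω → ℓ²(ℕ, ℂ))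
    (hmeas : ∀ i, Measurable (y i))
    (hindep : ProbabilityTheory.iIndepFun y P)
    (hident : ∀ i j, ProbabilityTheory.IdentDistrib (y i) (y j) P P)
    (hbound : ∀ i, ∀ᵐ ω ∂P, ‖y i ω‖ ≤ M)
    (Λ : ℓ²(ℕ, ℂ) →L[ℂ] ℓ²(ℕ, ℂ))
    (hΛ : ∀ i, Λ = ∫ ω, selfTensor (y i ω) ∂P)
    (hΛ_norm : ‖Λ‖ ≤ 1)
    (t : ℝ) (ht_pos : 0 < t) (ht_le : t ≤ 1) :
    P.real {ω | t ≤ ‖((1 / (n : ℂ)) • (∑ i, selfTensor (y i ω))) - Λ‖} ≤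
      (2 : ℝ) ^ (3 / 4 : ℝ) * n * Real.exp (-(t ^ 2 * n / (21 * M ^ 2))) := by
  have hn3 : (3 : ℝ) ≤ n := by exact_mod_cast hn
  have h2 : (1 : ℝ) ≤ (2 : ℝ) ^ (3 / 4 : ℝ) := Real.one_le_rpow (by norm_num) (by norm_num)
  set L := t ^ 2 * n / (21 * M ^ 2) with hLdef
  suffices h : P.real {ω | t ≤ ‖((1 / (n : ℂ)) • (∑ i, selfTensor (y i ω))) - Λ‖} ≤
      n * Real.exp (-L) by
    refine h.trans ?_
    rw [mul_assoc]
    exact le_mul_of_one_le_left (by positivity) h2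
  rcases lt_or_ge L 1 with hL | hL
  · -- Here the right-hand side is at least `3 / e`, which exceeds one.
    refine MeasureTheory.measureReal_le_one.trans ?_
    have h1 : Real.exp (-1) ≤ Real.exp (-L) := Real.exp_le_exp.2 (by linarith)
    have h3 : 1 / 3 ≤ Real.exp (-1) := by
      rw [Real.exp_neg, ← one_div]
      exact one_div_le_one_div_of_le (Real.exp_pos 1) (by linarith [Real.exp_one_lt_d9])
    nlinarith
  · have hLM : 21 * M ^ 2 * L = t ^ 2 * n := by rw [hLdef]; field_simp
    have h := (measureReal_norm_deviation_le (by omega) hM hmeas hindep hident hbound hΛ hΛ_norm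
      (p := ⌊L⌋₊) (Nat.floor_pos.2 hL) ht_pos).trans
      (moment_bound_le (by linarith) ht_pos ht_le hLM hL)
    exact le_of_mul_le_mul_right h (by positivity)
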